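/- Let $p$ be a prime number and let $\Sigma$ be a finite set of primes of $\mathbf{Q}$ containing $p$ and $\infty$. Let $\mathbf{Q}_\Sigma\subset\overline{\mathbf{Q}}$ be the maximal extension of $\mathbf{Q}$ unramified outside $\Sigma$. Let $\mathcal{F}$ be a finite extension of $\mathbf{Q}_p$ with ring of integers $\mathcal{O}$, let $d\ge 0$, and let $\rho:\mathrm{Gal}(\mathbf{Q}_\Sigma/\mathbf{Q})\to GL_d(\mathcal{O})$ be an Artin representation, i.e. a homomorphism which factors through $\mathrm{Gal}(K/\mathbf{Q})$ for some finite Galois extension $K/\mathbf{Q}$ with $K\subset\mathbf{Q}_\Sigma$. Let $R$ be a complete Noetherian local ring with finite residue field of characteristic $p$, equipped with the topology defined by the powers of its maximal ideal, and let $\tilde\rho$ be a deformation of $\rho$ with deformation ring $R$. That is, $\tilde\rho:\mathrm{Gal}(\mathbf{Q}_\Sigma/\mathbf{Q})\to GL_d(R)$ is a continuous homomorphism, and there is given a continuous surjective ring homomorphism $\phi_\rho:R\to\mathcal{O}$ such that $\phi_\rho\circ\tilde\rho=\rho$. Assume that $R$ is an integral domain. Let $q\ne p$ be a finite prime in $\Sigma$,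 let $v$ be a prime of $\mathbf{Q}_\Sigma$ lying over $q$, and let $I_v\subset\mathrm{Gal}(\mathbf{Q}_\Sigma/\mathbf{Q})$ be the inertia subgroup for $v$. Then the image $\tilde\rho(I_v)$ is finite. -/

import Mathlib

open scoped NumberField

noncomputable section

/- Subfields of `ℚ̄` get their `ℚ`-algebra structure as intermediate fields (it is the unique one). -/
attribute [-instance] DivisionRing.toRatAlgebra

/-- A subfield `L` of `ℚ̄` is unramified outside `S` if every prime number not in `S` is unramified
in (the ring of integers of) `L`. -/
def UnramifiedOutside (S : Finset ℕ) (L : IntermediateField ℚ (AlgebraicClosure ℚ)) : Prop :=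
  ∀ l : ℕ, l.Prime → l ∉ S → Algebra.IsUnramifiedIn (𝓞 L) (Ideal.span {(l : ℤ)})

/-- The field `ℚ_Σ` for `Σ = S ∪ {∞}`: the maximal extension of `ℚ` in `ℚ̄` unramified outside `Σ`,
i.e. the compositum of all finite extensions of `ℚ` that are unramified at every prime number
not in `S` (no condition is imposed at `∞`, as `∞ ∈ Σ`). -/
def maxUnramifiedOutside (S : Finset ℕ) : IntermediateField ℚ (AlgebraicClosure ℚ) :=
  ⨆ L : {L : IntermediateField ℚ (AlgebraicClosure ℚ) //
    FiniteDimensional ℚ L ∧ UnramifiedOutside S L}, L.1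

/-- The Galois group `Gal(ℚ_Σ/ℚ)`, with the Krull topology. -/
abbrev GalOutside (S : Finset ℕ) : Type := Gal(maxUnramifiedOutside S/ℚ)

/-- The ring of integers of a subfield `F` of `ℚ̄_p`, with the `p`-adic topology
(the one induced by the `p`-adic absolute value of `ℚ̄_p`). -/
abbrev padicIntegers (p : ℕ) [Fact p.Prime] (F : IntermediateField ℚ_[p] (PadicAlgCl p)) :
    Subalgebra ℤ_[p] F :=
  integralClosure ℤ_[p] F

/-- A representation `ρ` of `Gal(ℚ_Σ/ℚ)` over `O` is an Artin representation if it factors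
through `Gal(K/ℚ)` for some finite Galois extension `K/ℚ` contained in `ℚ_Σ`. -/
def IsArtinRepresentation {S : Finset ℕ} {d : ℕ} {O : Type*} [CommRing O]
    (ρ : GalOutside S →* GL (Fin d) O) : Prop :=
  ∃ (K : IntermediateField ℚ (maxUnramifiedOutside S)) (_ : FiniteDimensional ℚ K)
    (_ : IsGalois ℚ K) (ρ₀ : Gal(K/ℚ) →* GL (Fin d) O),
    ρ = ρ₀.comp (AlgEquiv.restrictNormalHom K)

/-- `ρ'` (over `R`) together with `φ : R → O` is a deformation of `ρ` (over `O`): `ρ'` is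
continuous, `φ` is a continuous surjective ring homomorphism, and `φ ∘ ρ' = ρ`. -/
structure IsDeformation {S : Finset ℕ} {d : ℕ} {O R : Type*}
    [CommRing O] [TopologicalSpace O] [CommRing R] [TopologicalSpace R]
    (ρ : GalOutside S →* GL (Fin d) O) (φ : R →+* O)
    (ρ' : GalOutside S →* GL (Fin d) R) : Prop where
  continuous_rep : Continuous ρ'
  continuous_hom : Continuous φ
  surjective_hom : Function.Surjective φ
  map_comp : (Matrix.GeneralLinearGroup.map φ).comp ρ' = ρ

end

/-! ### Inertia acting on the filtration by powers of a prime. -/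

section Ramification

variable {G B : Type*} [Group G] [CommRing B] [MulSemiringAction G B] {w : Ideal B}

/-! Let `σ` be a Frobenius at `v` and `x ∈ I_v`. The tame relation says that `y = σ x σ⁻¹ x⁻ᑫ` is
wild, hence has `q`-power order in every finite quotient. If `ρ' x` is trivial modulo the maximal
ideal, so is `ρ' y`; as `q` is a unit in `R`, this forces `ρ' y = 1`, that is, `A U A⁻¹ = U^q` with
`U = ρ' x` and `A = ρ' σ` (`conj_frobenius_eq_pow`).

Suppose also `ρ x = 1`, and let `m` be the order of the image of `ρ`. Then `U` and `A^m` are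
congruent to `1` modulo `P = ker φ`, and `A^m` conjugates `U` to `U^(q^m)`. Comparing leading terms
in the `P`-adic filtration gives `(q^m - 1)(U - 1) ≡ 0` at each level. Since `q^m - 1 ∉ P`, it is
invertible in `R_P`, and Krull's intersection theorem gives `U = 1` (`Ideal.eq_one_of_conj_eq_pow`),
as the domain `R` embeds in `R_P`. Thus on `I_v` the image of `ρ'` is determined by `ρ` and the
residual representation, both of finite image. -/

/-- A group element that maps `w` into itself maps the powers of `w` into themselves. -/
theorem Ideal.smul_mem_pow {g : G} (hg : ∀ b ∈ w, g • b ∈ w) (j : ℕ) {b : B} (hb : b ∈ w ^ j) :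
    g • b ∈ w ^ j := by
  have h : w.map (MulSemiringAction.toRingHom G B g) ≤ w :=
    Ideal.map_le_iff_le_comap.2 fun b hb ↦ hg b hb
  have := Ideal.mem_map_of_mem (MulSemiringAction.toRingHom G B g) hb
  rw [Ideal.map_pow] at this
  exact Ideal.pow_right_mono h j this

/-- If `z` acts trivially on `B/w` and on `w/w²`, it acts trivially on all `w^j/w^(j+1)`. -/
theorem Ideal.smul_sub_mem_pow_succ {z : G} (h₀ : ∀ b, z • b - b ∈ w)
    (h₁ : ∀ b ∈ w, z • b - b ∈ w ^ 2) (j : ℕ) {b : B} (hb : b ∈ w ^ j) :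
    z • b - b ∈ w ^ (j + 1) := by
  induction j generalizing b with
  | zero => simpa using h₀ b
  | succ j ih =>
    rw [pow_succ] at hb
    refine Submodule.mul_induction_on hb (fun a ha c hc ↦ ?_) (fun a c ha hc ↦ ?_)
    · have hzc : z • c ∈ w := by simpa using w.add_mem (h₀ c) hc
      have e : z • (a * c) - a * c = (z • a - a) * (z • c) + a * (z • c - c) := by
        rw [smul_mul']; ring
      rw [e]
      refine Ideal.add_mem _ ?_ ?_
      · rw [pow_succ]; exact Ideal.mul_mem_mul (ih ha) hzc
      · rw [add_assoc, pow_add]; exact Ideal.mul_mem_mul ha (h₁ c hc)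
    · have e : z • (a + c) - (a + c) = (z • a - a) + (z • c - c) := by
        rw [smul_add]; ring
      rw [e]
      exact Ideal.add_mem _ ha hc

/-- An element acting trivially on `B/w` and on `w/w²` and of finite order invertible modulo `w`
acts trivially. -/
theorem Ideal.smul_eq_self_of_pow_smul_eq_self [IsNoetherianRing B] [IsDomain B] (hw : w ≠ ⊤)
    {z : G} (h₀ : ∀ b, z • b - b ∈ w) (h₁ : ∀ b ∈ w, z • b - b ∈ w ^ 2) {s : ℕ} {a : B}
    (hs : a * s - 1 ∈ w) (hz : ∀ b : B, z ^ s • b = b) (b : B) : z • b = b := by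
  have hzw : ∀ b ∈ w, z • b ∈ w := fun b hb ↦ by simpa using w.add_mem (h₀ b) hb
  have key : ∀ i : ℕ, ∀ b, z • b - b ∈ w ^ (i + 1) := by
    intro i
    induction i with
    | zero => simpa using h₀
    | succ i ih =>
      intro b
      set δ := z • b - b with hδ
      -- Since `z` fixes `δ` modulo `w ^ (i + 2)`, each application of `z` adds one `δ`; at `k = s`
      -- this gives `s * δ ≡ 0`.
      have hk : ∀ k : ℕ, z ^ k • b - b - k * δ ∈ w ^ (i + 1 + 1) := by
        intro k
        induction k with
        | zero => simp
        | succ k ihk =>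
          have hcast : z • (k : B) = k := map_natCast (MulSemiringAction.toRingHom G B z) k
          have e : z ^ (k + 1) • b - b - ((k + 1 : ℕ) : B) * δ =
              z • (z ^ k • b - b - k * δ) + k * (z • δ - δ) := by
            rw [smul_sub, smul_sub, smul_mul', hcast, pow_succ', mul_smul, Nat.cast_succ]
            have : z • b = δ + b := by rw [hδ]; ring
            rw [this]; ring
          rw [e]
          exact Ideal.add_mem _ (Ideal.smul_mem_pow hzw _ ihk)
            (Ideal.mul_mem_left _ _ (Ideal.smul_sub_mem_pow_succ h₀ h₁ _ (ih b)))
      have h := hk s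
      rw [hz b, sub_self, zero_sub] at h
      have e : δ = a * (s * δ) - (a * s - 1) * δ := by ring
      rw [e]
      refine Ideal.sub_mem _ (Ideal.mul_mem_left _ _ (by simpa using h)) ?_
      rw [pow_succ' w (i + 1)]
      exact Ideal.mul_mem_mul hs (ih b)
  have h : z • b - b ∈ ⨅ i : ℕ, w ^ i := by
    rw [Submodule.mem_iInf]
    exact fun i ↦ Ideal.pow_le_pow_right (Nat.le_succ i) (key i b)
  rw [Ideal.iInf_pow_eq_bot_of_isDomain w hw, Ideal.mem_bot] at h
  exact sub_eq_zero.1 h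

/-- An element of the inertia group acts on `w/w²` by a scalar. -/
theorem Ideal.exists_smul_sub_mul_mem_sq [IsDedekindDomain B] [w.IsPrime] (hw : w ≠ ⊥) {x : G}
    (hx : ∀ b, x • b - b ∈ w) : ∃ c : B, ∀ b ∈ w, x • b - c * b ∈ w ^ 2 := by
  -- `π` is a uniformizer, and the scalar `c` is the ratio of `x • π` to `π`.
  obtain ⟨π, hπ, hπ2⟩ := Ideal.exists_mem_pow_notMem_pow_succ w hw Ideal.IsPrime.ne_top' 1
  have hxw : ∀ b ∈ w, x • b ∈ w := fun b hb ↦ by simpa using w.add_mem (hx b) hb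
  have hπ' : π ∈ w := by simpa using hπ
  obtain ⟨c, e, he, hc⟩ := Ideal.exists_mul_add_mem_pow_succ hw π (x • π) hπ hπ2
    (by simpa using hxw π hπ')
  refine ⟨c, fun b hb ↦ ?_⟩
  obtain ⟨a, f, hf, rfl⟩ := Ideal.exists_mul_add_mem_pow_succ hw π b hπ hπ2 (by simpa using hb)
  have e : x • (π * a + f) - c * (π * a + f) =
      (x • π) * (x • a - a) + a * e + (x • f - c * f) := by
    rw [smul_add, smul_mul', ← hc]; ring
  rw [e]
  refine Ideal.add_mem _ (Ideal.add_mem _ ?_ (Ideal.mul_mem_left _ _ he))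
    (Ideal.sub_mem _ (Ideal.smul_mem_pow hxw _ hf) (Ideal.mul_mem_left _ _ hf))
  rw [pow_two]
  exact Ideal.mul_mem_mul (hxw π hπ') (hx a)

/-- If `σ` is a Frobenius element and `x` an element of the inertia group of `w`, then
`σ x σ⁻¹ x⁻ᑫ` belongs to the wild inertia group: it acts trivially on `B/w` and on `w/w²`. -/
theorem Ideal.conj_frobenius_mul_inv_pow [IsDedekindDomain B] [w.IsPrime] (hw : w ≠ ⊥) {q : ℕ}
    {σ x : G} (hσ : ∀ b, σ • b - b ^ q ∈ w) (hq : q ≠ 0) (hx : ∀ b, x • b - b ∈ w) :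
    (∀ b, (σ * x * σ⁻¹ * (x ^ q)⁻¹) • b - b ∈ w) ∧
      ∀ b ∈ w, (σ * x * σ⁻¹ * (x ^ q)⁻¹) • b - b ∈ w ^ 2 := by
  have hσw : ∀ b ∈ w, σ • b ∈ w := fun b hb ↦ by
    simpa using w.add_mem (hσ b) (w.pow_mem_of_mem hb q (Nat.pos_of_ne_zero hq))
  have hσ'w : ∀ b ∈ w, σ⁻¹ • b ∈ w := fun b hb ↦ by
    have h := hσ (σ⁻¹ • b)
    rw [smul_inv_smul] at h
    exact ‹w.IsPrime›.mem_of_pow_mem q (by simpa using w.sub_mem hb h)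
  have hxI : x ∈ w.inertia G := hx
  have hinv : (x ^ q)⁻¹ ∈ w.inertia G := inv_mem (pow_mem hxI q)
  have hconj : σ * x * σ⁻¹ ∈ w.inertia G := fun b ↦ by
    have := hσw _ (hx (σ⁻¹ • b))
    rwa [smul_sub, smul_inv_smul, ← mul_smul, ← mul_smul] at this
  refine ⟨mul_mem hconj hinv, fun b hb ↦ ?_⟩
  obtain ⟨c, hc⟩ := Ideal.exists_smul_sub_mul_mem_sq hw hx
  have hxw : ∀ b ∈ w, x • b ∈ w := fun b hb ↦ by simpa using w.add_mem (hx b) hb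
  have hpow : ∀ k : ℕ, ∀ b ∈ w, x ^ k • b - c ^ k * b ∈ w ^ 2 := by
    intro k
    induction k with
    | zero => intro b _; simp
    | succ k ih =>
      intro b hb
      have e : x ^ (k + 1) • b - c ^ (k + 1) * b =
          (x ^ k • (x • b) - c ^ k * (x • b)) + c ^ k * (x • b - c * b) := by
        rw [pow_succ, mul_smul]; ring
      rw [e]
      exact Ideal.add_mem _ (ih _ (hxw b hb)) (Ideal.mul_mem_left _ _ (hc b hb))
  -- Conjugation by `σ` replaces the scalar `c` by `σ • c`, which is `c ^ q` modulo `w`; `x ^ q` has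
  -- the same scalar.
  have hconj2 : ∀ b ∈ w, (σ * x * σ⁻¹) • b - c ^ q * b ∈ w ^ 2 := by
    intro b hb
    have h := Ideal.smul_mem_pow hσw 2 (hc _ (hσ'w b hb))
    rw [smul_sub, smul_mul', smul_inv_smul, ← mul_smul, ← mul_smul] at h
    have e : (σ * x * σ⁻¹) • b - c ^ q * b =
        ((σ * x * σ⁻¹) • b - σ • c * b) + (σ • c - c ^ q) * b := by ring
    rw [e]
    refine Ideal.add_mem _ h ?_
    rw [pow_two]
    exact Ideal.mul_mem_mul (hσ c) hb
  have hb' : (x ^ q)⁻¹ • b ∈ w := by simpa using w.add_mem (hinv b) hb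
  have h := Ideal.sub_mem _ (hconj2 _ hb') (hpow q _ hb')
  rwa [smul_inv_smul, ← mul_smul, sub_sub_sub_cancel_right] at h

end Ramification

/-! ### Matrices congruent to the identity. -/

section Matrices

open Matrix

variable {n R : Type*} [Fintype n] [DecidableEq n] [CommRing R]

theorem Ideal.mul_mem_matrix_mul {I J : Ideal R} {X Y : Matrix n n R} (hX : X ∈ I.matrix n)
    (hY : Y ∈ J.matrix n) : X * Y ∈ (I * J).matrix n := fun i j ↦
  Ideal.sum_mem _ fun k _ ↦ Ideal.mul_mem_mul (hX i k) (hY k j)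

theorem Ideal.mul_mem_matrix_right {I : Ideal R} {X : Matrix n n R} (hX : X ∈ I.matrix n)
    (Y : Matrix n n R) : X * Y ∈ I.matrix n := fun i _ ↦
  Ideal.sum_mem _ fun k _ ↦ Ideal.mul_mem_right _ _ (hX i k)

theorem Ideal.mem_matrix_of_isUnit_smul_mem {I : Ideal R} {a : R} (ha : IsUnit a)
    {X : Matrix n n R} (hX : a • X ∈ I.matrix n) : X ∈ I.matrix n := fun i j ↦ by
  have := hX i j
  rw [Matrix.smul_apply, smul_eq_mul] at this
  exact (Ideal.unit_mul_mem_iff_mem I ha).1 this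

/-- First order expansion of `(1 + X)^N` for a matrix `X` congruent to zero. -/
theorem Ideal.one_add_pow_sub_mem_matrix {J : Ideal R} {k : ℕ} (hk : k ≠ 0) {X : Matrix n n R}
    (hX : X ∈ (J ^ k).matrix n) (N : ℕ) :
    (1 + X) ^ N - 1 - (N : R) • X ∈ (J ^ (k + 1)).matrix n := by
  have hXX : X * X ∈ (J ^ (k + 1)).matrix n := by
    have h := Ideal.mul_mem_matrix_mul hX hX
    rw [← pow_add] at h
    exact Ideal.matrix_monotone n (Ideal.pow_le_pow_right (by omega)) h
  induction N with
  | zero => simp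
  | succ N ih =>
    have e : (1 + X) ^ (N + 1) - 1 - ((N + 1 : ℕ) : R) • X =
        (1 + X) * ((1 + X) ^ N - 1 - (N : R) • X) + ((N : R) • (1 : Matrix n n R)) * (X * X) := by
      rw [pow_succ', Nat.cast_succ, add_smul, one_smul]
      simp only [mul_sub, add_mul, one_mul, mul_one, smul_mul_assoc, mul_smul_comm, smul_add]
      abel
    rw [e]
    exact Ideal.add_mem _ (Ideal.mul_mem_left _ _ ih) (Ideal.mul_mem_left _ _ hXX)

/-- A matrix congruent to `1` modulo `J` whose `N`-th power is congruent to `1` modulo `J^m` is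
congruent to `1` modulo `J^m` if `N` is invertible. -/
theorem Ideal.mem_matrix_pow_of_pow_sub_one_mem {J : Ideal R} {N : ℕ} (hN : IsUnit (N : R))
    {Y : Matrix n n R} (hY : Y - 1 ∈ J.matrix n) {m : ℕ} (h : Y ^ N - 1 ∈ (J ^ m).matrix n) :
    Y - 1 ∈ (J ^ m).matrix n := by
  suffices H : ∀ k ≤ m, Y - 1 ∈ (J ^ k).matrix n from H m le_rfl
  intro k
  induction k with
  | zero => intro _ i j; simp
  | succ k ih =>
    intro hk
    -- The quadratic error lies in `J ^ (2 * k)`, which is deep enough only for `k ≥ 1`.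
    rcases eq_or_ne k 0 with rfl | hk0
    · simpa using hY
    have h1 := Ideal.one_add_pow_sub_mem_matrix hk0 (ih (by omega)) N
    rw [add_sub_cancel] at h1
    have h2 := Ideal.sub_mem _ (Ideal.matrix_monotone n (Ideal.pow_le_pow_right hk) h) h1
    rw [sub_sub_cancel] at h2
    exact Ideal.mem_matrix_of_isUnit_smul_mem hN h2

/-- Rigidity: if `A U A⁻¹ = U^q` where `U` and `A^m` are congruent to `1` modulo an ideal `J` with
`⋂ J^i = 0` and `q^m - 1` is invertible, then `U = 1`. -/
theorem Ideal.eq_one_of_conj_eq_pow {J : Ideal R} (hJ : ⨅ i : ℕ, J ^ i = ⊥) {q m : ℕ}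
    (hqm : IsUnit (((q ^ m : ℕ) : R) - 1)) {U A : GL n R} (hUA : A * U * A⁻¹ = U ^ q)
    (hU : (U : Matrix n n R) - 1 ∈ J.matrix n)
    (hA : ((A ^ m : GL n R) : Matrix n n R) - 1 ∈ J.matrix n) : U = 1 := by
  have hconj : ∀ k : ℕ, A ^ k * U * (A ^ k)⁻¹ = U ^ q ^ k := by
    intro k
    induction k with
    | zero => simp
    | succ k ih =>
      have e : A ^ (k + 1) * U * (A ^ (k + 1))⁻¹ = A * (A ^ k * U * (A ^ k)⁻¹) * A⁻¹ := by
        rw [pow_succ', _root_.mul_inv_rev]; simp only [mul_assoc]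
      rw [e, ih, ← conj_pow, hUA, ← pow_mul, pow_succ']
  set N := q ^ m
  set C : Matrix n n R := ((A ^ m : GL n R) : Matrix n n R)
  set X : Matrix n n R := (U : Matrix n n R) - 1 with hX
  have hCU : C * (1 + X) = (1 + X) ^ N * C := by
    have h := hconj m
    rw [mul_inv_eq_iff_eq_mul] at h
    have := congrArg (Units.val) h
    simpa [C, X, N] using this
  have key : ∀ k : ℕ, X ∈ (J ^ (k + 1)).matrix n := by
    intro k
    induction k with
    | zero => simpa using hU
    | succ k ih =>
      have hE := Ideal.one_add_pow_sub_mem_matrix k.succ_ne_zero ih N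
      set E := (1 + X) ^ N - 1 - (N : R) • X with hEdef
      have hpow : (1 + X) ^ N = 1 + (N : R) • X + E := by rw [hEdef]; abel
      refine Ideal.mem_matrix_of_isUnit_smul_mem hqm ?_
      -- Every term on the right lies in `J ^ (k + 2)`: `C - 1` contributes one factor of `J`, and
      -- `E` is already that deep.
      have e : ((N : R) - 1) • X = (C - 1) * X - (N : R) • (X * (C - 1)) - E * C := by
        have h : C * X = (N : R) • (X * C) + E * C := by
          rw [hpow] at hCU
          simp only [mul_add, add_mul, mul_one, one_mul, smul_mul_assoc] at hCU
          rw [add_assoc] at hCU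
          exact add_left_cancel hCU
        clear_value X E C
        simp only [sub_mul, h, mul_sub, smul_sub, sub_smul, one_mul, mul_one, one_smul]
        abel
      rw [e]
      refine Ideal.sub_mem _ (Ideal.sub_mem _ ?_ ?_) (Ideal.mul_mem_matrix_right hE C)
      · rw [pow_succ']
        exact Ideal.mul_mem_matrix_mul hA ih
      · rw [← smul_mul_assoc, pow_succ, smul_mul_assoc, ← one_mul (X * (C - 1)), ← smul_mul_assoc]
        exact Ideal.mul_mem_left _ _ (Ideal.mul_mem_matrix_mul ih hA)
  refine Units.ext (sub_eq_zero.1 (Matrix.ext fun i j ↦ ?_))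
  have : X i j ∈ ⨅ i : ℕ, J ^ i :=
    (Submodule.mem_iInf _).2 fun k ↦ Ideal.pow_le_pow_right k.le_succ (key k i j)
  rwa [hJ] at this

end Matrices

/-! ### `ℚ_Σ` is Galois over `ℚ`. -/

section Unramified

theorem Algebra.IsUnramifiedIn.of_algEquiv {R A B : Type*} [CommRing R] [CommRing A] [CommRing B]
    [Algebra R A] [Algebra R B] {P : Ideal R} (h : Algebra.IsUnramifiedIn A P) (e : A ≃ₐ[R] B) :
    Algebra.IsUnramifiedIn B P := by
  intro Q _ hQ
  have : (Q.comap e).LiesOver P := ⟨by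
    rw [hQ.over]
    ext r
    simp [Ideal.under]⟩
  have := h (Q.comap e) inferInstance this
  exact Algebra.FormallyUnramified.of_equiv (Localization.localAlgEquiv (Q.comap e) Q e rfl)

attribute [-instance] DivisionRing.toRatAlgebra

theorem UnramifiedOutside.map {S : Finset ℕ} {L : IntermediateField ℚ (AlgebraicClosure ℚ)}
    (hL : UnramifiedOutside S L) (σ : AlgebraicClosure ℚ →ₐ[ℚ] AlgebraicClosure ℚ) :
    UnramifiedOutside S (L.map σ) := fun l hl hlS ↦
  (hL l hl hlS).of_algEquiv
    (NumberField.RingOfIntegers.mapRingEquiv (L.equivMap σ).toRingEquiv).toIntAlgEquiv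

/-- Ramification is invariant under isomorphism, so embeddings permute the fields whose compositum
is `ℚ_Σ`. -/
instance normal_maxUnramifiedOutside (S : Finset ℕ) : Normal ℚ (maxUnramifiedOutside S) := by
  rw [IntermediateField.normal_iff_forall_map_le]
  intro σ
  rw [maxUnramifiedOutside, IntermediateField.map_iSup]
  refine iSup_le fun L ↦ ?_
  have := L.2.1
  exact le_iSup (fun L : {L : IntermediateField ℚ (AlgebraicClosure ℚ) //
    FiniteDimensional ℚ L ∧ UnramifiedOutside S L} ↦ L.1)
    ⟨L.1.map σ, (L.1.equivMap σ).toLinearEquiv.finiteDimensional, L.2.2.map σ⟩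

instance isGalois_maxUnramifiedOutside (S : Finset ℕ) : IsGalois ℚ (maxUnramifiedOutside S) where

end Unramified

/-! ### Frobenius elements and the tame relation. -/

section Frobenius

variable {E : Type*} [Field E] [Algebra ℚ E]

attribute [-instance] DivisionRing.toRatAlgebra

instance isInvariant_ringOfIntegers [IsGalois ℚ E] : Algebra.IsInvariant ℤ (𝓞 E) Gal(E/ℚ) where
  isInvariant b hb := by
    obtain ⟨r, hr⟩ := (InfiniteGalois.mem_range_algebraMap_iff_fixed (k := ℚ) (b : E)).2 fun g ↦
      congrArg (algebraMap (𝓞 E) E) (hb g)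
    have hint : IsIntegral ℤ (algebraMap ℚ E r) := hr ▸ b.2
    obtain ⟨n, rfl⟩ := IsIntegrallyClosed.isIntegral_iff.1
      ((isIntegral_algebraMap_iff (algebraMap ℚ E).injective).1 hint)
    refine ⟨n, NumberField.RingOfIntegers.ext ?_⟩
    rw [← hr]
    simp

/-- A prime of the integers of a Galois extension of `ℚ`, possibly infinite, has a Frobenius. -/
theorem exists_frobenius [IsGalois ℚ E] {q : ℕ} (hq : q.Prime) (v : Ideal (𝓞 E)) [v.IsPrime]
    [v.LiesOver (Ideal.span {(q : ℤ)})] : ∃ σ : Gal(E/ℚ), ∀ b, σ • b - b ^ q ∈ v := by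
  have : Fact q.Prime := ⟨hq⟩
  have hP : (Ideal.span {(q : ℤ)}).IsMaximal :=
    Int.ideal_span_isMaximal_of_prime q
  have hv : v.IsMaximal := Ideal.IsMaximal.of_liesOver_isMaximal v (Ideal.span {(q : ℤ)})
  let : Field (ℤ ⧸ Ideal.span {(q : ℤ)}) := Ideal.Quotient.field _
  let : Field (𝓞 E ⧸ v) := Ideal.Quotient.field _
  let : Fintype (ℤ ⧸ Ideal.span {(q : ℤ)}) :=
    Fintype.ofEquiv _ (Int.quotientSpanNatEquivZMod q).toEquiv.symm
  have hcard : Fintype.card (ℤ ⧸ Ideal.span {(q : ℤ)}) = q := by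
    rw [Fintype.card_congr (Int.quotientSpanNatEquivZMod q).toEquiv, ZMod.card]
  -- The action on the discrete ring is continuous because each algebraic integer has open
  -- stabilizer; so the decomposition group surjects onto the residual automorphisms even when `E`
  -- is infinite.
  let : TopologicalSpace (𝓞 E) := ⊥
  have : DiscreteTopology (𝓞 E) := ⟨rfl⟩
  have : ContinuousSMul Gal(E/ℚ) (𝓞 E) := by
    rw [continuousSMul_iff_stabilizer_isOpen]
    intro x
    convert stabilizer_isOpen_of_isIntegral (K := ℚ) (x : E) using 1
    ext g
    exact NumberField.RingOfIntegers.ext_iff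
  obtain ⟨σ, hσ⟩ := Ideal.Quotient.stabilizerHom_surjective_of_profinite (G := Gal(E/ℚ))
    (Ideal.span {(q : ℤ)}) v
    (FiniteField.frobeniusAlgEquivOfAlgebraic (ℤ ⧸ Ideal.span {(q : ℤ)}) (𝓞 E ⧸ v))
  refine ⟨σ.1, fun b ↦ Ideal.Quotient.eq.1 ?_⟩
  have h := DFunLike.congr_fun hσ (Ideal.Quotient.mk v b)
  rw [FiniteField.coe_frobeniusAlgEquivOfAlgebraic, hcard] at h
  rw [map_pow]
  exact h

/-- For a Frobenius `σ` and an element `x` of inertia at `v ∣ q`, the element `σ x σ⁻¹ x⁻ᑫ` is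
pro-`q`: in every finite quotient its order is a power of `q`. -/
theorem exists_pow_mem_fixingSubgroup {q : ℕ} (hq : q.Prime) (v : Ideal (𝓞 E)) [v.IsPrime]
    [v.LiesOver (Ideal.span {(q : ℤ)})] {σ x : Gal(E/ℚ)} (hσ : ∀ b, σ • b - b ^ q ∈ v)
    (hx : x ∈ v.inertia Gal(E/ℚ)) (L : IntermediateField ℚ E) [FiniteDimensional ℚ L]
    [Normal ℚ L] : ∃ a : ℕ, (σ * x * σ⁻¹ * (x ^ q)⁻¹) ^ q ^ a ∈ L.fixingSubgroup := by
  have : NumberField L := {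
    to_charZero := algebraRat.charZero L
    to_finiteDimensional := by convert ‹FiniteDimensional ℚ L›; exact Subsingleton.elim _ _ }
  let r : Gal(E/ℚ) →* Gal(L/ℚ) := AlgEquiv.restrictNormalHom L
  let w : Ideal (𝓞 L) := v.comap (algebraMap (𝓞 L) (𝓞 E))
  have hr : ∀ (g : Gal(E/ℚ)) (b : 𝓞 L),
      algebraMap (𝓞 L) (𝓞 E) (r g • b) = g • algebraMap (𝓞 L) (𝓞 E) b := fun g b ↦
    NumberField.RingOfIntegers.ext (AlgEquiv.restrictNormal_commutes g L b)
  have hqw : (q : 𝓞 L) ∈ w := by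
    rw [Ideal.mem_comap, map_natCast]
    have : (q : ℤ) ∈ v.under ℤ := by
      rw [← Ideal.over_def v (Ideal.span {(q : ℤ)})]
      exact Ideal.mem_span_singleton_self _
    simpa using Ideal.mem_comap.1 this
  have hw : w ≠ ⊥ := fun h ↦ by
    rw [h, Ideal.mem_bot, Nat.cast_eq_zero] at hqw
    exact hq.ne_zero hqw
  obtain ⟨h₀, h₁⟩ := Ideal.conj_frobenius_mul_inv_pow hw (σ := r σ) (x := r x) (q := q)
    (fun b ↦ by rw [Ideal.mem_comap, map_sub, hr, map_pow]; exact hσ _) hq.ne_zero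
    (fun b ↦ by rw [Ideal.mem_comap, map_sub, hr]; exact hx _)
  set y := σ * x * σ⁻¹ * (x ^ q)⁻¹ with hy
  have hry : r σ * r x * (r σ)⁻¹ * (r x ^ q)⁻¹ = r y := by simp [hy]
  rw [hry] at h₀ h₁
  obtain ⟨a, s, hs, hord⟩ := Nat.exists_eq_pow_mul_and_not_dvd (orderOf_pos (r y)).ne' q hq.ne_one
  have hyw : r y ∈ w.inertia Gal(L/ℚ) := h₀
  have hpow : ∀ k : ℕ, ∀ b ∈ w, r y ^ k • b - b ∈ w ^ 2 := by
    intro k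
    induction k with
    | zero => simp
    | succ k ih =>
      intro b hb
      have hyb : r y • b ∈ w := by simpa using w.add_mem (h₀ b) hb
      have := Ideal.add_mem _ (ih _ hyb) (h₁ b hb)
      rwa [sub_add_sub_cancel, ← mul_smul, ← pow_succ] at this
  obtain ⟨u, t, hut⟩ :=
    Nat.isCoprime_iff_coprime.2 ((Nat.Prime.coprime_iff_not_dvd hq).2 hs).symm
  have hfix : ∀ b : 𝓞 L, r y ^ q ^ a • b = b :=
    Ideal.smul_eq_self_of_pow_smul_eq_self (s := s) (a := (u : 𝓞 L)) (Ideal.IsPrime.ne_top')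
      (pow_mem hyw _) (hpow _)
      (by
        have hut' : (u : 𝓞 L) * s + t * q = 1 := by exact_mod_cast congrArg (Int.cast : ℤ → 𝓞 L) hut
        rw [← hut', sub_add_cancel_left]
        exact neg_mem (w.mul_mem_left _ hqw))
      (fun b ↦ by rw [← pow_mul, ← hord, pow_orderOf_eq_one, one_smul])
  refine ⟨a, (IntermediateField.mem_fixingSubgroup_iff _ _).2 fun b hb ↦ ?_⟩
  have hfixL : ∀ b : L, r (y ^ q ^ a) b = b := by
    intro b
    obtain ⟨n, d, -, rfl⟩ := IsFractionRing.div_surjective (A := 𝓞 L) b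
    have h : ∀ c : 𝓞 L, r (y ^ q ^ a) (algebraMap (𝓞 L) L c) = algebraMap (𝓞 L) L c := fun c ↦ by
      rw [map_pow]; exact congrArg (algebraMap (𝓞 L) L) (hfix c)
    rw [map_div₀, h, h]
  have := AlgEquiv.restrictNormal_commutes (y ^ q ^ a) L ⟨b, hb⟩
  rw [show (y ^ q ^ a).restrictNormal L ⟨b, hb⟩ = ⟨b, hb⟩ from hfixL ⟨b, hb⟩] at this
  exact this.symm

end Frobenius

/-! ### Finiteness of the image of inertia. -/

section Representations

variable {E : Type*} [Field E] [Algebra ℚ E] [IsGalois ℚ E] {R n : Type*} [Fintype n]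
  [DecidableEq n] [CommRing R] [TopologicalSpace R]

attribute [-instance] DivisionRing.toRatAlgebra

/-- A continuous representation over a ring with the `J`-adic topology is trivial modulo `J^k` on
an open normal subgroup. -/
theorem exists_fixingSubgroup_sub_one_mem {J : Ideal R} (hJ : IsAdic J)
    {ρ : Gal(E/ℚ) →* GL n R} (hρ : Continuous ρ) (k : ℕ) :
    ∃ L : IntermediateField ℚ E, FiniteDimensional ℚ L ∧ Normal ℚ L ∧
      ∀ g ∈ L.fixingSubgroup, (ρ g : Matrix n n R) - 1 ∈ (J ^ k).matrix n := by
  have : IsTopologicalRing R := by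
    rw [IsAdic] at hJ
    rw [hJ]
    exact J.adic_basis.toRing_subgroups_basis.toRingFilterBasis.isTopologicalRing
  have hopen : IsOpen ((J ^ k : Ideal R) : Set R) := (isAdic_iff.1 hJ).1 k
  have hcont : ∀ i j, Continuous fun g ↦ ((ρ g : Matrix n n R) - 1) i j := fun i j ↦
    ((Units.continuous_val.comp hρ).matrix_elem i j).sub continuous_const
  let s : Set Gal(E/ℚ) := {g | ∀ i j, ((ρ g : Matrix n n R) - 1) i j ∈ J ^ k}
  have hs : IsOpen s := by
    have : s = ⋂ i, ⋂ j, (fun g ↦ ((ρ g : Matrix n n R) - 1) i j) ⁻¹' (J ^ k : Ideal R) := by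
      ext g; simp [s]
    rw [this]
    exact isOpen_iInter_of_finite fun i ↦ isOpen_iInter_of_finite fun j ↦
      hopen.preimage (hcont i j)
  have h1 : (1 : Gal(E/ℚ)) ∈ s := fun i j ↦ by simp
  obtain ⟨L, hfin, hnorm, hL⟩ :=
    (krullTopology_mem_nhds_one_iff_of_normal ℚ E s).1 (hs.mem_nhds h1)
  exact ⟨L, hfin, hnorm, fun g hg ↦ hL hg⟩

/-- The tame relation in a representation over a `J`-adic ring in which `q` is invertible, for
elements of inertia acting trivially modulo `J`. -/
theorem conj_frobenius_eq_pow {J : Ideal R} (hJ : IsAdic J) (hJbot : ⨅ i : ℕ, J ^ i = ⊥)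
    {ρ : Gal(E/ℚ) →* GL n R} (hρ : Continuous ρ) {q : ℕ} (hq : q.Prime) (hqR : IsUnit (q : R))
    (v : Ideal (𝓞 E)) [v.IsPrime] [v.LiesOver (Ideal.span {(q : ℤ)})] {σ x : Gal(E/ℚ)}
    (hσ : ∀ b, σ • b - b ^ q ∈ v) (hx : x ∈ v.inertia Gal(E/ℚ))
    (hxJ : Matrix.GeneralLinearGroup.map (Ideal.Quotient.mk J) (ρ x) = 1) :
    ρ σ * ρ x * (ρ σ)⁻¹ = ρ x ^ q := by
  have hρy : ρ (σ * x * σ⁻¹ * (x ^ q)⁻¹) = ρ σ * ρ x * (ρ σ)⁻¹ * (ρ x ^ q)⁻¹ := by simp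
  set y := σ * x * σ⁻¹ * (x ^ q)⁻¹
  have hyJ : (ρ y : Matrix n n R) - 1 ∈ J.matrix n := by
    have h : Matrix.GeneralLinearGroup.map (Ideal.Quotient.mk J) (ρ y) = 1 := by
      simp [hρy, hxJ]
    rw [Ideal.mem_matrix]
    intro i j
    have := congrArg (fun M : GL n (R ⧸ J) ↦ (M : Matrix n n (R ⧸ J)) i j) h
    rw [Matrix.sub_apply, ← Ideal.Quotient.eq]
    simpa [Matrix.one_apply, apply_ite (Ideal.Quotient.mk J)] using this
  have hy : ρ y = 1 := by
    refine Units.ext (sub_eq_zero.1 (Matrix.ext fun i j ↦ ?_))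
    have : ((ρ y : Matrix n n R) - 1) i j ∈ ⨅ i : ℕ, J ^ i := by
      refine (Submodule.mem_iInf _).2 fun k ↦ ?_
      -- Modulo `J ^ k` the representation factors through `Gal(L/ℚ)`, where `y` has `q`-power
      -- order.
      obtain ⟨L, _, _, hL⟩ := exists_fixingSubgroup_sub_one_mem hJ hρ k
      obtain ⟨a, ha⟩ := exists_pow_mem_fixingSubgroup hq v hσ hx L
      have h := hL _ ha
      rw [map_pow, Units.val_pow_eq_pow_val] at h
      exact Ideal.mem_matrix_pow_of_pow_sub_one_mem (by rw [Nat.cast_pow]; exact hqR.pow a) hyJ h i j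
    rwa [hJbot] at this
  rw [hρy] at hy
  exact mul_inv_eq_one.1 hy

/-- Let `ρ'` be a continuous representation over a Noetherian local domain `R` with its adic
topology and finite residue field, and `φ : R → O` a ring homomorphism to a domain of
characteristic zero such that `φ ∘ ρ'` has finite image. Then `ρ'` has finite image on inertia at
primes whose residue characteristic is invertible in `R`. -/
theorem finite_image_inertia [IsDomain R] [IsLocalRing R] [IsNoetherianRing R]
    [Finite (IsLocalRing.ResidueField R)] (hR : IsAdic (IsLocalRing.maximalIdeal R))
    {O : Type*} [CommRing O] [IsDomain O] [CharZero O] (φ : R →+* O)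
    {ρ : Gal(E/ℚ) →* GL n O} (hfin : (Set.range ρ).Finite)
    {ρ' : Gal(E/ℚ) →* GL n R} (hρ' : Continuous ρ')
    (hφρ : ∀ g, Matrix.GeneralLinearGroup.map φ (ρ' g) = ρ g)
    {q : ℕ} (hq : q.Prime) (hqR : IsUnit (q : R))
    (v : Ideal (𝓞 E)) [v.IsPrime] [v.LiesOver (Ideal.span {(q : ℤ)})] :
    (ρ' '' (v.inertia Gal(E/ℚ) : Set Gal(E/ℚ))).Finite := by
  have : Finite ρ.range := hfin
  let m := Nat.card ρ.range
  have hm : m ≠ 0 := Nat.card_pos.ne'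
  have hpow : ∀ g, ρ g ^ m = 1 := fun g ↦
    congrArg Subtype.val (pow_card_eq_one' (x := (⟨ρ g, g, rfl⟩ : ρ.range)))
  obtain ⟨σ, hσ⟩ := exists_frobenius hq v
  let P : Ideal R := RingHom.ker φ
  have : P.IsPrime := RingHom.ker_isPrime φ
  -- `q ^ m - 1` may be a non-unit in `R`, so rigidity is applied after localizing at `P`.
  let T := Localization.AtPrime P
  have hinj : Function.Injective (algebraMap R T) :=
    IsLocalization.injective T P.primeCompl_le_nonZeroDivisors
  have hker : ∀ g : Gal(E/ℚ), ρ g = 1 →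
      (Matrix.GeneralLinearGroup.map (algebraMap R T) (ρ' g) : Matrix n n T) - 1 ∈
        (IsLocalRing.maximalIdeal T).matrix n := by
    intro g hg i j
    have hP : ((ρ' g : Matrix n n R) - 1) i j ∈ P := by
      have h := congrArg (fun M : GL n (O) ↦
        (M : Matrix n n (O)) i j) ((hφρ g).trans hg)
      rw [RingHom.mem_ker, Matrix.sub_apply, map_sub, sub_eq_zero]
      simpa [Matrix.one_apply, apply_ite φ] using h
    have h := (IsLocalization.AtPrime.to_map_mem_maximal_iff T P _).2 hP
    rw [Matrix.sub_apply, map_sub] at h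
    simpa [Matrix.one_apply, apply_ite (algebraMap R T)] using h
  have hunit : IsUnit (((q ^ m : ℕ) : T) - 1) := by
    -- Characteristic zero of `O` keeps `q ^ m - 1` nonzero under `φ`.
    have h : ((q ^ m : ℕ) : R) - 1 ∈ P.primeCompl := fun h ↦ by
      have h' : φ (((q ^ m : ℕ) : R) - 1) = 0 := h
      rw [map_sub, map_natCast, map_one, sub_eq_zero, ← Nat.cast_one, Nat.cast_inj] at h'
      exact (Nat.one_lt_pow hm hq.one_lt).ne' h'
    simpa using IsLocalization.map_units T ⟨_, h⟩
  have key : ∀ x ∈ v.inertia (Gal(E/ℚ)), ρ x = 1 →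
      Matrix.GeneralLinearGroup.map (IsLocalRing.residue R) (ρ' x) = 1 → ρ' x = 1 := by
    intro x hx hρx hres
    have hconj := conj_frobenius_eq_pow hR
      (Ideal.iInf_pow_eq_bot_of_isLocalRing _ (Ideal.IsPrime.ne_top'))
      hρ' hq hqR v hσ hx hres
    have h1 := Ideal.eq_one_of_conj_eq_pow (m := m)
      (Ideal.iInf_pow_eq_bot_of_isLocalRing (IsLocalRing.maximalIdeal T) Ideal.IsPrime.ne_top')
      hunit (U := Matrix.GeneralLinearGroup.map (algebraMap R T) (ρ' x))
      (A := Matrix.GeneralLinearGroup.map (algebraMap R T) (ρ' σ))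
      (by simpa using congrArg (Matrix.GeneralLinearGroup.map (algebraMap R T)) hconj)
      (hker x hρx) (by
        rw [← map_pow, ← map_pow]
        exact hker _ (by rw [map_pow, hpow]))
    refine Matrix.GeneralLinearGroup.ext fun i j ↦ hinj ?_
    have := congrArg (fun M : GL n T ↦ (M : Matrix n n T) i j) h1
    simpa [Matrix.one_apply, apply_ite (algebraMap R T)] using this
  let f : GL n R → GL n (O) × GL n (IsLocalRing.ResidueField R) :=
    fun g ↦ (Matrix.GeneralLinearGroup.map φ g,
      Matrix.GeneralLinearGroup.map (IsLocalRing.residue R) g)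
  refine Set.Finite.of_finite_image (f := f) ((hfin.prod Set.finite_univ).subset ?_) ?_
  · rintro _ ⟨_, ⟨x, -, rfl⟩, rfl⟩
    exact ⟨⟨x, (hφρ x).symm⟩, trivial⟩
  · rintro _ ⟨x, hx, rfl⟩ _ ⟨y, hy, rfl⟩ hxy
    obtain ⟨h1, h2⟩ := Prod.ext_iff.1 hxy
    have h := key (x * y⁻¹) (mul_mem hx (inv_mem hy))
      (by rw [map_mul, map_inv, mul_inv_eq_one, ← hφρ, ← hφρ]; exact h1)
      (by rw [map_mul, map_inv, map_mul, map_inv, mul_inv_eq_one]; exact h2)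
    rwa [map_mul, map_inv, mul_inv_eq_one] at h

theorem IsArtinRepresentation.finite_range {S : Finset ℕ} {d : ℕ} {O : Type*} [CommRing O]
    {ρ : GalOutside S →* GL (Fin d) O} (hρ : IsArtinRepresentation ρ) : (Set.range ρ).Finite := by
  obtain ⟨K, _, _, ρ₀, rfl⟩ := hρ
  exact (Set.finite_range ρ₀).subset (by rintro _ ⟨g, rfl⟩; exact ⟨_, rfl⟩)

theorem IsDeformation.finite_image_inertia {S : Finset ℕ} {d : ℕ} {O R : Type*}
    [CommRing O] [IsDomain O] [CharZero O] [TopologicalSpace O] [CommRing R] [TopologicalSpace R]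
    [IsDomain R] [IsLocalRing R] [IsNoetherianRing R] [Finite (IsLocalRing.ResidueField R)]
    (hR : IsAdic (IsLocalRing.maximalIdeal R)) {ρ : GalOutside S →* GL (Fin d) O} {φ : R →+* O}
    {ρ' : GalOutside S →* GL (Fin d) R} (hρ : IsArtinRepresentation ρ)
    (hdef : IsDeformation ρ φ ρ') {q : ℕ} (hq : q.Prime) (hqR : IsUnit (q : R))
    (v : Ideal (𝓞 (maxUnramifiedOutside S))) [v.IsPrime] [v.LiesOver (Ideal.span {(q : ℤ)})] :
    (ρ' '' (v.inertia (GalOutside S) : Set (GalOutside S))).Finite :=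
  _root_.finite_image_inertia hR φ hρ.finite_range hdef.continuous_rep
    (DFunLike.congr_fun hdef.map_comp) hq hqR v

end Representations

theorem theorem5p6
    (p : ℕ) [Fact p.Prime]
    -- the finite primes of `Σ = S ∪ {∞}`
    (S : Finset ℕ) (hS : ∀ l ∈ S, l.Prime) (hpS : p ∈ S)
    -- the coefficient field, a finite extension of `ℚ_p`, and the Artin representation `ρ`
    (F : IntermediateField ℚ_[p] (PadicAlgCl p)) [FiniteDimensional ℚ_[p] F]
    (d : ℕ) (ρ : GalOutside S →* GL (Fin d) (padicIntegers p F))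
    (hρ : IsArtinRepresentation ρ)
    -- the deformation ring: a complete Noetherian local domain with finite residue field of
    -- characteristic `p`, with the topology given by the powers of its maximal ideal
    {R : Type*} [CommRing R] [IsDomain R] [IsLocalRing R] [IsNoetherianRing R]
    [IsAdicComplete (IsLocalRing.maximalIdeal R) R]
    [Finite (IsLocalRing.ResidueField R)] [CharP (IsLocalRing.ResidueField R) p]
    [TopologicalSpace R] (hR : IsAdic (IsLocalRing.maximalIdeal R))
    -- the deformation
    (φ : R →+* padicIntegers p F) (ρ' : GalOutside S →* GL (Fin d) R)
    (hdef : IsDeformation ρ φ ρ')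
    -- a finite prime `q ≠ p` in `Σ` and a prime `v` of `ℚ_Σ` over `q`
    (q : ℕ) (hqS : q ∈ S) (hqp : q ≠ p)
    (v : Ideal (𝓞 (maxUnramifiedOutside S))) [v.IsPrime] [v.LiesOver (Ideal.span {(q : ℤ)})] :
    (ρ' '' (v.inertia (GalOutside S) : Set (GalOutside S))).Finite := by
  have hq : q.Prime := hS q hqS
  -- Otherwise `q` would vanish in the residue field, forcing `p ∣ q`.
  have hqR : IsUnit (q : R) := by
    by_contra h
    have h0 := (IsLocalRing.residue_eq_zero_iff (q : R)).2 ((IsLocalRing.mem_maximalIdeal _).2 h)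
    rw [map_natCast, CharP.cast_eq_zero_iff (IsLocalRing.ResidueField R) p] at h0
    exact hqp (((Nat.prime_dvd_prime_iff_eq Fact.out hq).1 h0).symm)
  exact hdef.finite_image_inertia hR hρ hq hqR v
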